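/- Let $n<\omega$. A cylindric algebra of dimension $\alpha$ ($\mathsf{CA}_\alpha$) is a Boolean algebra with unary operations $\mathsf c_i$ and constants $\mathsf d_{ij}$ ($i,j<\alpha$) satisfying, for all $x,y$ and all $i,j,k<\alpha$: $\mathsf c_i0=0$; $x\le \mathsf c_ix$; $\mathsf c_i(x\cdot \mathsf c_iy)=\mathsf c_ix\cdot \mathsf c_iy$; $\mathsf c_i\mathsf c_jx=\mathsf c_j\mathsf c_ix$; $\mathsf d_{ii}=1$; $\mathsf d_{jk}=\mathsf c_i(\mathsf d_{ji}\cdot \mathsf d_{ik})$ if $i\ne j,k$; $\mathsf c_i(\mathsf d_{ij}\cdot x)\cdot \mathsf c_i(\mathsf d_{ij}\cdot -x)=0$ if $i\neq j$. For $\mathfrak D\in\mathsf{CA}_\omega$ the neat reduct $\mathfrak{Nr}_n\mathfrak D\in \mathsf{CA}_n$ has universe $\{a\in D:\mathsf c_ia=a \text{ for all } n\le i<\omega\}$ and the operations of $\mathfrak D$ with indices $<n$. $S_c\mathfrak{Nr}_n\mathsf{CA}_\omega$ is the class of all $\mathfrak A\in\mathsf{CA}_n$ for which there are $\mathfrak D\in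 \mathsf{CA}_\omega$ and an embedding $e:\mathfrak A\to\mathfrak{Nr}_n\mathfrak D$ such that for every $S\subseteq A$, if $\sum S=1$ in $\mathfrak A$ then $\sum e(S)=1$ in $\mathfrak{Nr}_n\mathfrak D$. Finally, $\wp({}^nM)$ is the full cylindric set algebra of all subsets of ${}^nM$, with $\mathsf c_iY=\{s: t\in Y \text{ for some } t \text{ with } t_j=s_j \text{ for all } j\ne i\}$ and $\mathsf d_{ij}=\{s:s_i=s_j\}$. **Theorem (ZFC).** Let $\mathfrak A\in S_c\mathfrak{Nr}_n\mathsf{CA}_\omega$ be countable, let $\kappa<2^{\aleph_0}$ be a cardinal, and let $(X_i:i<\kappa)$ be a family of non-principal Boolean ultrafilters of $\mathfrak A$. Then for every non-zero $a\in A$ there are a non-empty countable set $M$ and a homomorphism $f:\mathfrak A\to\wp({}^nM)$ of cylindric algebras such that $f(a)\neq\emptyset$ and $\bigcap_{x\in X_i}f(x)=\emptyset$ for all $i<\kappa$. -/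

import Mathlib

universe u v w

/-- Cylindric algebras `CA_α` of dimension `α` (the index set of the cylindrifications), on top of
a Boolean algebra: `cyl i` is the cylindrification `c_i` and `diag i j` the diagonal element
`d_{ij}`, subject to the usual equations of Henkin, Monk and Tarski. -/
class CylindricAlgebra (α : Type*) (A : Type*) [BooleanAlgebra A] where
  cyl : α → A → A
  diag : α → α → A
  cyl_bot : ∀ i, cyl i ⊥ = ⊥
  le_cyl : ∀ i x, x ≤ cyl i x
  cyl_inf_cyl : ∀ i x y, cyl i (x ⊓ cyl i y) = cyl i x ⊓ cyl i y
  cyl_comm : ∀ i j x, cyl i (cyl j x) = cyl j (cyl i x)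
  diag_self : ∀ i, diag i i = ⊤
  diag_eq_cyl : ∀ i j k, i ≠ j → i ≠ k → diag j k = cyl i (diag j i ⊓ diag i k)
  cyl_diag_inf : ∀ i j x, i ≠ j → cyl i (diag i j ⊓ x) ⊓ cyl i (diag i j ⊓ xᶜ) = ⊥

namespace CylindricAlgebra

/-- Homomorphisms of cylindric algebras of the same dimension `α`. -/
structure IsHom (α : Type*) {A B : Type*} [BooleanAlgebra A] [BooleanAlgebra B]
    [CylindricAlgebra α A] [CylindricAlgebra α B] (f : A → B) : Prop where
  map_bot : f ⊥ = ⊥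
  map_top : f ⊤ = ⊤
  map_sup : ∀ x y, f (x ⊔ y) = f x ⊔ f y
  map_inf : ∀ x y, f (x ⊓ y) = f x ⊓ f y
  map_compl : ∀ x, f xᶜ = (f x)ᶜ
  map_cyl : ∀ (i : α) x, f (cyl i x) = cyl i (f x)
  map_diag : ∀ i j : α, f (diag i j) = diag i j

/-- The full cylindric set algebra `℘(^α M)`: the subsets of `^α M` with
`c_i S = {s : some t ∈ S agrees with s off i}` and `d_{ij} = {s : s_i = s_j}`. -/
instance setAlgebra (α M : Type*) : CylindricAlgebra α (Set (α → M)) where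
  cyl i S := {s | ∃ t ∈ S, ∀ j, j ≠ i → t j = s j}
  diag i j := {s | s i = s j}
  cyl_bot i := by ext s; simp
  le_cyl i S := fun s hs => ⟨s, hs, fun _ _ => rfl⟩
  cyl_inf_cyl i S T := by
    ext s
    constructor
    · rintro ⟨t, ⟨htS, r, hrT, hr⟩, ht⟩
      exact ⟨⟨t, htS, ht⟩, r, hrT, fun j hj => (hr j hj).trans (ht j hj)⟩
    · rintro ⟨⟨t, htS, ht⟩, r, hrT, hr⟩
      exact ⟨t, ⟨htS, r, hrT, fun j hj => (hr j hj).trans (ht j hj).symm⟩, ht⟩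
  cyl_comm i j S := by
    classical
    have key : ∀ i j : α, ∀ s : α → M,
        (∃ t : α → M, (∃ r ∈ S, ∀ k, k ≠ j → r k = t k) ∧ ∀ k, k ≠ i → t k = s k) →
        ∃ t : α → M, (∃ r ∈ S, ∀ k, k ≠ i → r k = t k) ∧ ∀ k, k ≠ j → t k = s k := by
      rintro i j s ⟨t, ⟨r, hr, hrt⟩, hts⟩
      refine ⟨fun k => if k = i then s k else r k, ⟨r, hr, fun k hk => by simp [hk]⟩, ?_⟩
      intro k hk
      by_cases h : k = i
      · simp [h]
      · simp [h, hrt k hk, hts k h]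
    ext s
    exact ⟨key i j s, key j i s⟩
  diag_self i := by ext s; simp
  diag_eq_cyl i j k hij hik := by
    classical
    ext s
    constructor
    · intro h
      refine ⟨Function.update s i (s j), ⟨?_, ?_⟩, fun l hl => by simp [hl]⟩
      · simp [Ne.symm hij]
      · have h' : s j = s k := h
        simp [Ne.symm hik, h']
    · rintro ⟨t, ⟨h1, h2⟩, ht⟩
      have h1' : t j = t i := h1
      have h2' : t i = t k := h2
      change s j = s k
      rw [← ht j (Ne.symm hij), ← ht k (Ne.symm hik), h1', h2']
  cyl_diag_inf i j S hij := by
    rw [← le_bot_iff]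
    rintro s ⟨⟨t, ⟨ht, htS⟩, hts⟩, r, ⟨hr, hrS⟩, hrs⟩
    have : t = r := by
      funext k
      by_cases hk : k = i
      · subst hk
        have e1 : t k = t j := ht
        have e2 : r k = r j := hr
        rw [e1, e2, hts j (Ne.symm hij), hrs j (Ne.symm hij)]
      · rw [hts k hk, hrs k hk]
    exact (hrS (this ▸ htS)).elim

section Basic

variable {α D : Type*} [BooleanAlgebra D] [CylindricAlgebra α D]

theorem cyl_mono (i : α) {x y : D} (h : x ≤ y) : cyl i x ≤ cyl i y := by
  have h1 := cyl_inf_cyl i x y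
  rw [inf_eq_left.2 (h.trans (le_cyl i y))] at h1
  exact inf_eq_left.1 h1.symm

theorem cyl_top (i : α) : cyl i (⊤ : D) = ⊤ := top_le_iff.1 (le_cyl i ⊤)

theorem cyl_cyl (i : α) (x : D) : cyl i (cyl i x) = cyl i x := by
  have h := cyl_inf_cyl i ⊤ x
  rwa [top_inf_eq, cyl_top, top_inf_eq] at h

theorem cyl_inf_of_fixed (i : α) {x y : D} (hx : cyl i x = x) (hy : cyl i y = y) :
    cyl i (x ⊓ y) = x ⊓ y := by
  have h := cyl_inf_cyl i x y
  rwa [hx, hy] at h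

theorem cyl_compl_of_fixed (i : α) {x : D} (hx : cyl i x = x) : cyl i xᶜ = xᶜ := by
  refine le_antisymm ?_ (le_cyl i _)
  rw [le_compl_iff_disjoint_right, disjoint_iff]
  have h := cyl_inf_cyl i xᶜ x
  rw [hx, compl_inf_eq_bot, cyl_bot] at h
  exact h.symm

theorem cyl_sup_of_fixed (i : α) {x y : D} (hx : cyl i x = x) (hy : cyl i y = y) :
    cyl i (x ⊔ y) = x ⊔ y := by
  have h := cyl_compl_of_fixed i
    (cyl_inf_of_fixed i (cyl_compl_of_fixed i hx) (cyl_compl_of_fixed i hy))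
  simpa using h

theorem cyl_diag_of_ne {i j k : α} (hij : i ≠ j) (hik : i ≠ k) :
    cyl i (diag j k : D) = diag j k := by
  rw [diag_eq_cyl i j k hij hik, cyl_cyl]

end Basic

/-- The universe `Nr_n D = {a ∈ D : c_i a = a for all i ∈ ω \ n}` of the neat `n`-reduct
of an `ω`-dimensional cylindric algebra `D`, as a Boolean subalgebra of `D`. -/
def nrSubalgebra (n : ℕ) (D : Type*) [BooleanAlgebra D] [CylindricAlgebra ℕ D] :
    BooleanSubalgebra D where
  carrier := {a | ∀ i : ℕ, n ≤ i → cyl i a = a}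
  supClosed' _ hx _ hy i hi := cyl_sup_of_fixed i (hx i hi) (hy i hi)
  infClosed' _ hx _ hy i hi := cyl_inf_of_fixed i (hx i hi) (hy i hi)
  compl_mem' hx i hi := cyl_compl_of_fixed i (hx i hi)
  bot_mem' i _ := cyl_bot i

/-- The neat `n`-reduct `Nr_n D`, with the operations `c_i`, `d_{ij}` for `i, j < n` only. -/
abbrev Nr (n : ℕ) (D : Type*) [BooleanAlgebra D] [CylindricAlgebra ℕ D] : Type _ :=
  nrSubalgebra n D

instance nrAlgebra (n : ℕ) (D : Type*) [BooleanAlgebra D] [CylindricAlgebra ℕ D] :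
    CylindricAlgebra (Fin n) (Nr n D) where
  cyl i x := ⟨cyl (i : ℕ) (x : D), fun j hj => by rw [cyl_comm, x.2 j hj]⟩
  diag i j := ⟨diag (i : ℕ) (j : ℕ), fun k hk => cyl_diag_of_ne (by omega) (by omega)⟩
  cyl_bot i := Subtype.ext (cyl_bot (i : ℕ))
  le_cyl i x := le_cyl (i : ℕ) (x : D)
  cyl_inf_cyl i x y := Subtype.ext (cyl_inf_cyl (i : ℕ) (x : D) (y : D))
  cyl_comm i j x := Subtype.ext (cyl_comm (i : ℕ) (j : ℕ) (x : D))
  diag_self i := Subtype.ext (diag_self (i : ℕ))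
  diag_eq_cyl i j k hij hik :=
    Subtype.ext (diag_eq_cyl (i : ℕ) j k (Fin.val_ne_of_ne hij) (Fin.val_ne_of_ne hik))
  cyl_diag_inf i j x hij :=
    Subtype.ext (cyl_diag_inf (i : ℕ) j (x : D) (Fin.val_ne_of_ne hij))

/-- `A ∈ S_c Nr_n CA_ω`: there are `D ∈ CA_ω` and an embedding `e` of `A` into the neat reduct
`Nr_n D` such that `∑ S = 1` in `A` implies `∑ e(S) = 1` in `Nr_n D`, for all `S ⊆ A`. -/
def MemScNr (n : ℕ) (A : Type u) [BooleanAlgebra A] [CylindricAlgebra (Fin n) A] : Prop :=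
  ∃ (D : Type v) (_ : BooleanAlgebra D) (_ : CylindricAlgebra ℕ D) (e : A → Nr n D),
    IsHom (Fin n) e ∧ Function.Injective e ∧
      ∀ S : Set A, IsLUB S ⊤ → IsLUB (e '' S) ⊤

end CylindricAlgebra

/-- `F` is a (proper) ultrafilter of the Boolean algebra `A`. -/
structure IsBooleanUltrafilter {A : Type*} [BooleanAlgebra A] (F : Set A) : Prop where
  top_mem : ⊤ ∈ F
  bot_notMem : ⊥ ∉ F
  mem_of_le : ∀ x y, x ∈ F → x ≤ y → y ∈ F
  inf_mem : ∀ x y, x ∈ F → y ∈ F → x ⊓ y ∈ F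
  mem_or_compl_mem : ∀ x, x ∈ F ∨ xᶜ ∈ F

/-- `F` is the principal filter generated by one element. -/
def IsPrincipalFilter {A : Type*} [BooleanAlgebra A] (F : Set A) : Prop :=
  ∃ a : A, F = Set.Ici a

/-!
The proof is a Henkin construction in the `ω`-dimensional algebra `D` whose neat reduct contains
`A`, combined with Shelah's argument for omitting fewer than `2^ℵ₀` complete types.

The variables `≥ n` serve as Henkin constants. For `τ : Fin n → ℕ` the substitution `s_τ`
(`substAll τ`) replaces each variable `i < n` by `n + τ i`; since no new variable is among the old
ones, it is a composition of commuting Boolean endomorphisms `x ↦ c_i (d_{ij} · x)`. A proper filter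
`F` of `D` that decides each `s_τ x` with `x ∈ A` and contains a witness for each `s_τ c_i x` in it
gives a model: its points are the numbers `k`, identified along `d_{n+k,n+l} ∈ F`, and the tuple `τ`
satisfies `x` when `s_τ x ∈ F` (`exists_isHom_of_henkin`).

Such filters are generated by descending sequences of conditions, the conditions being the non-zero
finite-dimensional elements of `D`. Working only with these replaces the passage to the subalgebra
generated by `A`, and makes suprema preserved in `Nr_n D` behave well in `D`: if `⋀ U = 0` in `A`
then the image of `U` under `s_τ` has no non-zero finite-dimensional lower bound
(`eq_bot_of_forall_le`, `eq_bot_of_le_substList`). Since `A` is countable, there are countably many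
requirements to meet.

A binary tree of conditions gives one filter for each `b : ℕ → Bool`, and the tree can be built such
that the types of two tuples in two different filters either differ or are principal: when two
conditions `p`, `q` cannot be extended so as to make the types of `τ` and `σ` differ, `p` decides the
type of `τ` completely, and a type all of whose elements lie above one condition cannot have infimum
`0`, hence is principal (`Condition.exists_separates_or_isolates`). So each non-principal `X i` is
realized in at most one of the `2^ℵ₀` models, and as there are fewer than `2^ℵ₀` of them, some model
omits them all.
-/

namespace CylindricAlgebra

/-! ### Substitutions in cylindric algebras -/

section Substitution

variable {α D : Type*} [BooleanAlgebra D] [CylindricAlgebra α D]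

theorem cyl_sup (i : α) (x y : D) : cyl i (x ⊔ y) = cyl i x ⊔ cyl i y := by
  refine le_antisymm ?_ (sup_le (cyl_mono i le_sup_left) (cyl_mono i le_sup_right))
  rw [← cyl_sup_of_fixed i (cyl_cyl i x) (cyl_cyl i y)]
  exact cyl_mono i (sup_le_sup (le_cyl i x) (le_cyl i y))

theorem cyl_inf_left_of_fixed (i : α) {x : D} (y : D) (hx : cyl i x = x) :
    cyl i (x ⊓ y) = x ⊓ cyl i y := by
  have h := cyl_inf_cyl i y x
  rwa [hx, inf_comm, inf_comm (cyl i y)] at h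

theorem ne_bot_of_cyl_ne_bot {i : α} {x : D} (h : cyl i x ≠ ⊥) : x ≠ ⊥ := by
  rintro rfl
  exact h (cyl_bot i)

theorem eq_bot_of_cyl_eq_bot {i : α} {x : D} (h : cyl i x = ⊥) : x = ⊥ :=
  le_bot_iff.1 (h ▸ le_cyl i x)

theorem cyl_diag_inf_diag {i j : α} (hij : i ≠ j) : cyl i (diag j i ⊓ diag i j : D) = ⊤ := by
  rw [← diag_eq_cyl i j j hij hij, diag_self]

theorem cyl_diag_left {i j : α} (hij : i ≠ j) : cyl i (diag i j : D) = ⊤ :=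
  top_le_iff.1 ((cyl_diag_inf_diag hij).ge.trans (cyl_mono i inf_le_right))

theorem diag_le_diag_swap {i j : α} (hij : i ≠ j) : (diag i j : D) ≤ diag j i := by
  have h := cyl_diag_inf i j (diag j i : D) hij
  rw [inf_comm (diag i j : D), cyl_diag_inf_diag hij, top_inf_eq] at h
  have h' := eq_bot_of_cyl_eq_bot h
  rwa [← sdiff_eq, sdiff_eq_bot_iff] at h'

theorem diag_comm (i j : α) : (diag i j : D) = diag j i := by
  rcases eq_or_ne i j with rfl | h
  · rfl
  · exact le_antisymm (diag_le_diag_swap h) (diag_le_diag_swap h.symm)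

theorem cyl_diag_right {i j : α} (hij : i ≠ j) : cyl j (diag i j : D) = ⊤ := by
  rw [diag_comm, cyl_diag_left hij.symm]

theorem diag_trans (i j k : α) : (diag i j ⊓ diag j k : D) ≤ diag i k := by
  rcases eq_or_ne j i with rfl | h
  · exact inf_le_right
  rcases eq_or_ne j k with rfl | h'
  · exact inf_le_left
  rw [diag_eq_cyl j i k h h']
  exact le_cyl _ _

/-- The substitution `s^i_j x = c_i (d_{ij} · x)` of the variable `j` for the variable `i`. It is
meant for `i ≠ j` only. -/
def subst (i j : α) (x : D) : D := cyl i (diag i j ⊓ x)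

theorem subst_mono (i j : α) {x y : D} (h : x ≤ y) : subst i j x ≤ subst i j y :=
  cyl_mono i (inf_le_inf_left _ h)

theorem subst_le_cyl (i j : α) (x : D) : subst i j x ≤ cyl i x := cyl_mono i inf_le_right

theorem subst_of_fixed {i j : α} (hij : i ≠ j) {x : D} (hx : cyl i x = x) : subst i j x = x := by
  rw [subst, inf_comm, cyl_inf_left_of_fixed i _ hx, cyl_diag_left hij, inf_top_eq]

theorem subst_top {i j : α} (hij : i ≠ j) : subst i j (⊤ : D) = ⊤ :=
  subst_of_fixed hij (cyl_top i)

theorem subst_compl {i j : α} (hij : i ≠ j) (x : D) : subst i j xᶜ = (subst i j x)ᶜ := by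
  refine (IsCompl.compl_eq ⟨disjoint_iff.2 (cyl_diag_inf i j x hij), codisjoint_iff.2 ?_⟩).symm
  rw [← cyl_sup, ← inf_sup_left, sup_compl_eq_top, inf_top_eq, cyl_diag_left hij]

theorem subst_sup (i j : α) (x y : D) : subst i j (x ⊔ y) = subst i j x ⊔ subst i j y := by
  rw [subst, inf_sup_left, cyl_sup]; rfl

theorem cyl_subst {i j k : α} (hki : k ≠ i) (hkj : k ≠ j) (x : D) :
    cyl k (subst i j x) = subst i j (cyl k x) := by
  rw [subst, cyl_comm, cyl_inf_left_of_fixed k _ (cyl_diag_of_ne hki hkj)]; rfl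

/-- Renaming `i` to a variable `k` that does not occur in `x`, and then quantifying `k`, is the
same as quantifying `i`. -/
theorem cyl_subst_of_fixed {i k : α} (hik : i ≠ k) {x : D} (hx : cyl k x = x) :
    cyl k (subst i k x) = cyl i x := by
  rw [subst, cyl_comm, inf_comm, cyl_inf_left_of_fixed k _ hx, cyl_diag_right hik, inf_top_eq]

theorem subst_comm {i j k l : α} (hik : i ≠ k) (hil : i ≠ l) (hkj : k ≠ j) (x : D) :
    subst i j (subst k l x) = subst k l (subst i j x) := by
  have h : ∀ {i j k l : α} (_ : i ≠ k) (_ : k ≠ j), subst i j (subst k l x) =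
      cyl i (cyl k (diag i j ⊓ (diag k l ⊓ x))) := by
    intro i j k l hik hkj
    rw [subst, subst, cyl_inf_left_of_fixed k _ (cyl_diag_of_ne hik.symm hkj)]
  rw [h hik hkj, h hik.symm hil, cyl_comm, inf_left_comm]

theorem diag_inf_subst_le {i j : α} (hij : i ≠ j) (x : D) : diag i j ⊓ subst i j x ≤ x := by
  have h : diag i j ⊓ xᶜ ≤ (subst i j x)ᶜ := by
    rw [← subst_compl hij]
    exact le_cyl _ _
  have h' := disjoint_iff.1 ((disjoint_compl_right (a := subst i j x)).mono_right h)
  rwa [← inf_assoc, ← sdiff_eq, sdiff_eq_bot_iff, inf_comm] at h'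

theorem subst_diag {i j k : α} (hij : i ≠ j) (hik : i ≠ k) :
    subst i j (diag i k : D) = diag j k := by
  rw [subst, diag_comm i j, ← diag_eq_cyl i j k hij hik]

/-- A substitution of `j` for `i` changes to one of `k` for `i` under a condition `p` without `i`
that implies `j = k`. -/
theorem inf_subst_le {i j k : α} {p x y : D} (hp : cyl i p = p)
    (hpd : p ≤ diag j k) (h : p ⊓ x ≤ y) : p ⊓ subst i j x ≤ subst i k y := by
  rw [subst, ← cyl_inf_left_of_fixed i _ hp]
  refine cyl_mono i (le_inf ?_ ?_)
  · refine le_trans (le_inf ?_ ?_) (diag_trans i j k)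
    · exact inf_le_right.trans inf_le_left
    · exact inf_le_left.trans hpd
  · exact (inf_le_inf_left p inf_le_right).trans h

end Substitution

section SubstList

variable {n : ℕ} {D : Type*} [BooleanAlgebra D] [CylindricAlgebra ℕ D]

/-- The simultaneous substitution of the variables `n + τ i` for the variables `i < n` that occur
in the list. As the new variables are all `≥ n`, they never clash with those being replaced, and
the single substitutions may be composed in any order. -/
def substList (τ : Fin n → ℕ) : List (Fin n) → D → D
  | [], x => x
  | i :: l, x => subst (i : ℕ) (n + τ i) (substList τ l x)

theorem val_ne_add (i : Fin n) (k : ℕ) : (i : ℕ) ≠ n + k := by omega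

variable (τ σ : Fin n → ℕ)

theorem substList_append (l l' : List (Fin n)) (x : D) :
    substList τ (l ++ l') x = substList τ l (substList τ l' x) := by
  induction l with
  | nil => rfl
  | cons i l ih => simp only [List.cons_append, substList, ih]

theorem substList_perm {l l' : List (Fin n)} (h : l.Perm l') (x : D) :
    substList τ l x = substList τ l' x := by
  induction h with
  | nil => rfl
  | cons i _ ih => simp only [substList, ih]
  | swap i j l =>
    rcases eq_or_ne j i with rfl | hij
    · rfl
    · exact subst_comm (Fin.val_ne_of_ne hij) (val_ne_add _ _) (val_ne_add _ _) _
  | trans _ _ h₁ h₂ => exact h₁.trans h₂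

theorem substList_mono (l : List (Fin n)) {x y : D} (h : x ≤ y) :
    substList τ l x ≤ substList τ l y := by
  induction l with
  | nil => exact h
  | cons i l ih => exact subst_mono _ _ ih

theorem substList_top (l : List (Fin n)) : substList τ l (⊤ : D) = ⊤ := by
  induction l with
  | nil => rfl
  | cons i l ih => rw [substList, ih, subst_top (val_ne_add _ _)]

theorem substList_compl (l : List (Fin n)) (x : D) :
    substList τ l xᶜ = (substList τ l x)ᶜ := by
  induction l with
  | nil => rfl
  | cons i l ih => rw [substList, ih, subst_compl (val_ne_add _ _)]; rfl

theorem substList_sup (l : List (Fin n)) (x y : D) :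
    substList τ l (x ⊔ y) = substList τ l x ⊔ substList τ l y := by
  induction l with
  | nil => rfl
  | cons i l ih => rw [substList, ih, subst_sup]; rfl

theorem cyl_substList {k : ℕ} (l : List (Fin n)) (h : ∀ i ∈ l, k ≠ i ∧ k ≠ n + τ i) (x : D) :
    cyl k (substList τ l x) = substList τ l (cyl k x) := by
  induction l with
  | nil => rfl
  | cons i l ih =>
    rw [substList, cyl_subst (h i (by simp)).1 (h i (by simp)).2,
      ih fun j hj => h j (by simp [hj])]
    rfl

theorem substList_of_fixed (l : List (Fin n)) {x : D} (hx : ∀ i ∈ l, cyl (i : ℕ) x = x) :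
    substList τ l x = x := by
  induction l with
  | nil => rfl
  | cons i l ih =>
    rw [substList, ih fun j hj => hx j (by simp [hj]),
      subst_of_fixed (val_ne_add _ _) (hx i (by simp))]

theorem substList_congr {τ σ : Fin n → ℕ} {l : List (Fin n)} (h : ∀ i ∈ l, τ i = σ i) (x : D) :
    substList τ l x = substList σ l x := by
  induction l with
  | nil => rfl
  | cons i l ih =>
    rw [substList, ih fun j hj => h j (by simp [hj]), h i (by simp)]; rfl

theorem inf_substList_le {l : List (Fin n)} {p : D} (hp : ∀ i ∈ l, cyl (i : ℕ) p = p)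
    (hpd : ∀ i ∈ l, p ≤ diag (n + τ i) (n + σ i)) (x : D) :
    p ⊓ substList τ l x ≤ substList σ l x := by
  induction l with
  | nil => exact inf_le_right
  | cons i l ih =>
    exact inf_subst_le (hp i (by simp)) (hpd i (by simp))
      (ih (fun j hj => hp j (by simp [hj])) fun j hj => hpd j (by simp [hj]))

/-- The simultaneous substitution `s_τ` of the variables `n + τ i` for all variables `i < n`. -/
def substAll (τ : Fin n → ℕ) (x : D) : D := substList τ (List.finRange n) x

theorem substAll_top : substAll τ (⊤ : D) = ⊤ := substList_top τ _

theorem substAll_compl (x : D) : substAll τ xᶜ = (substAll τ x)ᶜ := substList_compl τ _ x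

theorem substAll_sup (x y : D) : substAll τ (x ⊔ y) = substAll τ x ⊔ substAll τ y :=
  substList_sup τ _ x y

theorem substAll_bot : substAll τ (⊥ : D) = ⊥ := by
  rw [← compl_top, substAll_compl, substAll_top, compl_top]

theorem substAll_inf (x y : D) : substAll τ (x ⊓ y) = substAll τ x ⊓ substAll τ y := by
  rw [← compl_inj_iff, ← substAll_compl, compl_inf, substAll_sup, substAll_compl, substAll_compl,
    compl_inf]

theorem finRange_perm_append (i : Fin n) :
    (List.finRange n).Perm ((List.finRange n).erase i ++ [i]) :=
  (List.perm_cons_erase (List.mem_finRange i)).trans (List.perm_append_singleton _ _).symm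

theorem substAll_eq_substList_erase (i : Fin n) (x : D) :
    substAll τ x = substList τ ((List.finRange n).erase i) (subst (i : ℕ) (n + τ i) x) := by
  rw [substAll, substList_perm τ (finRange_perm_append i), substList_append]; rfl

theorem substAll_update_eq (i : Fin n) (k : ℕ) (x : D) :
    substAll (Function.update τ i k) x =
      substList τ ((List.finRange n).erase i) (subst (i : ℕ) (n + k) x) := by
  rw [substAll_eq_substList_erase _ i, Function.update_self]
  refine substList_congr (fun j hj => Function.update_of_ne ?_ _ _) _
  rintro rfl
  exact ((List.nodup_finRange n).not_mem_erase) hj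

theorem substAll_cyl (i : Fin n) (x : D) :
    substAll τ (cyl (i : ℕ) x) = substList τ ((List.finRange n).erase i) (cyl (i : ℕ) x) := by
  rw [substAll_eq_substList_erase _ i, subst_of_fixed (val_ne_add _ _) (cyl_cyl _ x)]

theorem substAll_update_le (i : Fin n) (k : ℕ) (x : D) :
    substAll (Function.update τ i k) x ≤ substAll τ (cyl (i : ℕ) x) := by
  rw [substAll_update_eq, substAll_cyl]
  exact substList_mono τ _ (subst_le_cyl _ _ x)

/-- Quantifying a fresh variable `n + k` put in place of `i` gives `s_τ c_i`: the algebraic form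
of the Henkin axioms. -/
theorem cyl_substAll_update (i : Fin n) {k : ℕ} (hk : ∀ j, k ≠ τ j) {x : D}
    (hx : cyl (n + k) x = x) :
    cyl (n + k) (substAll (Function.update τ i k) x) = substAll τ (cyl (i : ℕ) x) := by
  rw [substAll_update_eq, substAll_cyl,
    cyl_substList τ _ fun j _ => ⟨(val_ne_add j k).symm, by have := hk j; omega⟩,
    cyl_subst_of_fixed (val_ne_add _ _) hx]

theorem substAll_diag (i j : Fin n) :
    substAll τ (diag (i : ℕ) (j : ℕ) : D) = diag (n + τ i) (n + τ j) := by
  rcases eq_or_ne i j with rfl | hij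
  · rw [diag_self, diag_self, substAll_top]
  rw [substAll_eq_substList_erase τ i, subst_diag (val_ne_add _ _) (Fin.val_ne_of_ne hij)]
  have hmem : j ∈ (List.finRange n).erase i :=
    (List.mem_erase_of_ne hij.symm).2 (List.mem_finRange j)
  have hperm := (List.perm_cons_erase hmem).trans (List.perm_append_singleton j _).symm
  rw [substList_perm τ hperm, substList_append]
  change substList τ _ (subst (j : ℕ) (n + τ j) (diag (n + τ i) (j : ℕ))) = _
  rw [diag_comm _ (j : ℕ), subst_diag (val_ne_add _ _) (val_ne_add _ _), diag_comm]
  exact substList_of_fixed τ _ fun m _ =>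
    cyl_diag_of_ne (val_ne_add _ _) (val_ne_add _ _)

/-- Where the variables `n + τ i` and `n + σ i` are equal for all `i`, the substitutions `s_τ` and
`s_σ` agree. -/
theorem inf_substAll_le (x : D) :
    (Finset.univ.inf fun i => diag (n + τ i) (n + σ i)) ⊓ substAll τ x ≤ substAll σ x := by
  refine inf_substList_le τ σ (fun i _ => ?_) (fun i _ => Finset.inf_le (Finset.mem_univ i)) x
  refine Finset.inf_induction (p := fun y : D => cyl (i : ℕ) y = y) (cyl_top _)
    (fun _ hx _ hy => cyl_inf_of_fixed _ hx hy) fun j _ => ?_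
  exact cyl_diag_of_ne (val_ne_add _ _) (val_ne_add _ _)

/-! ### Finite-dimensional elements -/

/-- The element `x` depends on finitely many variables only. -/
def IsFiniteDim (x : D) : Prop := ∃ m : ℕ, ∀ k, m ≤ k → cyl k x = x

theorem IsFiniteDim.inf {x y : D} (hx : IsFiniteDim x) (hy : IsFiniteDim y) :
    IsFiniteDim (x ⊓ y) := by
  obtain ⟨m, hm⟩ := hx
  obtain ⟨m', hm'⟩ := hy
  exact ⟨max m m', fun k hk => cyl_inf_of_fixed k (hm k (le_of_max_le_left hk))
    (hm' k (le_of_max_le_right hk))⟩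

theorem IsFiniteDim.compl {x : D} (hx : IsFiniteDim x) : IsFiniteDim xᶜ := by
  obtain ⟨m, hm⟩ := hx
  exact ⟨m, fun k hk => cyl_compl_of_fixed k (hm k hk)⟩

theorem IsFiniteDim.cyl {x : D} (hx : IsFiniteDim x) (i : ℕ) :
    IsFiniteDim (CylindricAlgebra.cyl i x) := by
  obtain ⟨m, hm⟩ := hx
  exact ⟨m, fun k hk => by rw [cyl_comm, hm k hk]⟩

theorem isFiniteDim_diag (i j : ℕ) : IsFiniteDim (diag i j : D) :=
  ⟨max i j + 1, fun k hk => cyl_diag_of_ne (by omega) (by omega)⟩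

theorem IsFiniteDim.substList {x : D} (hx : IsFiniteDim x) (l : List (Fin n)) :
    IsFiniteDim (substList τ l x) := by
  induction l with
  | nil => exact hx
  | cons i l ih => exact ((isFiniteDim_diag _ _).inf ih).cyl _

theorem isFiniteDim_coe (x : Nr n D) : IsFiniteDim (x : D) := ⟨n, x.2⟩

theorem isFiniteDim_substAll (x : Nr n D) : IsFiniteDim (substAll τ (x : D)) :=
  (isFiniteDim_coe x).substList τ _

/-- Quantifying the finitely many variables `≥ n` of a finite-dimensional element puts it into the
neat reduct. -/
theorem IsFiniteDim.exists_nr {x : D} (hx : IsFiniteDim x) :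
    ∃ y : Nr n D, x ≤ y ∧ ∀ z : Nr n D, x ≤ z → y ≤ z := by
  obtain ⟨m, hm⟩ := hx
  have key : ∀ j : ℕ, ∃ y : D, x ≤ y ∧ (∀ z : Nr n D, x ≤ z → y ≤ z) ∧
      (∀ k, n ≤ k → k < n + j → CylindricAlgebra.cyl k y = y) ∧
      ∀ k, m ≤ k → CylindricAlgebra.cyl k y = y := by
    intro j
    induction j with
    | zero => exact ⟨x, le_rfl, fun _ h => h, fun k _ _ => by omega, hm⟩
    | succ j ih =>
      obtain ⟨y, hxy, hyz, hn, hm'⟩ := ih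
      refine ⟨CylindricAlgebra.cyl (n + j) y, hxy.trans (le_cyl _ _), fun z hz => ?_,
        fun k hk hk' => ?_, fun k hk => by rw [cyl_comm, hm' k hk]⟩
      · rw [← z.2 (n + j) (Nat.le_add_right _ _)]
        exact cyl_mono _ (hyz z hz)
      · rcases Nat.lt_succ_iff_lt_or_eq.1 hk' with h | rfl
        · rw [cyl_comm, hn k hk h]
        · exact cyl_cyl _ _
  obtain ⟨y, hxy, hyz, hn, hm'⟩ := key m
  refine ⟨⟨y, fun k hk => ?_⟩, hxy, hyz⟩
  rcases lt_or_ge k (n + m) with h | h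
  · exact hn k hk h
  · exact hm' k (by omega)

/-- Substitutions preserve the property that a family has no non-zero finite-dimensional lower
bound. -/
theorem eq_bot_of_le_substList {B : Type*} {g : B → D} {U : Set B}
    (hg : ∀ p : D, IsFiniteDim p → (∀ x ∈ U, p ≤ g x) → p = ⊥) (l : List (Fin n)) :
    ∀ p : D, IsFiniteDim p → (∀ x ∈ U, p ≤ substList τ l (g x)) → p = ⊥ := by
  induction l with
  | nil => exact hg
  | cons i l ih =>
    intro p hp hpU
    have hij := val_ne_add i (τ i)
    have h := ih (diag (i : ℕ) (n + τ i) ⊓ cyl (i : ℕ) p)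
      ((isFiniteDim_diag _ _).inf (hp.cyl _)) fun x hx => by
        refine le_trans (inf_le_inf_left _ ?_) (diag_inf_subst_le hij _)
        have := cyl_mono (i : ℕ) (hpU x hx)
        rwa [substList, subst, cyl_cyl] at this
    have h' := subst_of_fixed hij (cyl_cyl (i : ℕ) p)
    rw [subst, h, cyl_bot] at h'
    exact eq_bot_of_cyl_eq_bot h'.symm

theorem substList_ne_bot {τ : Fin n → ℕ} (hτ : Function.Injective τ) {l : List (Fin n)}
    (hl : l.Nodup) {x : Nr n D} (hx : x ≠ ⊥) : substList τ l (x : D) ≠ ⊥ := by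
  induction l with
  | nil => exact fun h => hx (Subtype.ext h)
  | cons i l ih =>
    obtain ⟨hi, hl⟩ := List.nodup_cons.1 hl
    intro h
    refine ih hl (eq_bot_of_cyl_eq_bot (i := (i : ℕ)) ?_)
    rw [← cyl_subst_of_fixed (k := n + τ i) (val_ne_add _ _)]
    · change subst _ _ _ = _ at h
      rw [h, cyl_bot]
    · rw [cyl_substList τ l, x.2 _ (Nat.le_add_right _ _)]
      refine fun j hj => ⟨(val_ne_add _ _).symm, fun e => hi ?_⟩
      rwa [hτ (Nat.add_left_cancel e)]

end SubstList

end CylindricAlgebra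

/-! ### Trees of conditions -/

section Tree

variable {P : Type*} [Preorder P]

/-- Finitely many dense sets that are closed downwards are met by one condition. -/
theorem exists_le_forall_mem_of_dense {κ : Type*} (R : κ → P → Prop)
    (hmono : ∀ k p q, q ≤ p → R k p → R k q) (hdense : ∀ k p, ∃ q ≤ p, R k q)
    (s : Finset κ) (p : P) : ∃ q ≤ p, ∀ k ∈ s, R k q := by
  classical
  induction s using Finset.induction_on with
  | empty => exact ⟨p, le_rfl, by simp⟩
  | insert k s _ ih =>
    obtain ⟨q, hqp, hq⟩ := ih
    obtain ⟨r, hrq, hr⟩ := hdense k q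
    refine ⟨r, hrq.trans hqp, fun j hj => ?_⟩
    rcases Finset.mem_insert.1 hj with rfl | hj
    · exact hr
    · exact hmono j q r hrq (hq j hj)

/-- Given countably many dense sets `A k` of conditions and countably many dense binary relations
`R k` between conditions, there is a tree of conditions each branch of which meets all `A k`, and
any two branches of which are related by all `R k` from some level on. -/
theorem exists_branches (A : ℕ → P → Prop) (R : ℕ → P → P → Prop)
    (hA : ∀ k p q, q ≤ p → A k p → A k q)
    (hR : ∀ k p q p' q', p' ≤ p → q' ≤ q → R k p q → R k p' q')
    (hA' : ∀ k p, ∃ q ≤ p, A k q)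
    (hR' : ∀ k p q, ∃ p' ≤ p, ∃ q' ≤ q, R k p' q') (p₀ : P) :
    ∃ Φ : (ℕ → Bool) → ℕ → P, (∀ x, Antitone (Φ x)) ∧ (∀ x, Φ x 0 = p₀) ∧
      (∀ x k, ∃ m, A k (Φ x m)) ∧ ∀ x y, x ≠ y → ∀ k, ∃ m, R k (Φ x m) (Φ y m) := by
  classical
  -- All nodes of one level are extended at once, as one element of a product order.
  have step : ∀ (m : ℕ) (f : (Fin m → Bool) → P), ∃ g : (Fin (m + 1) → Bool) → P,
      (∀ s, g s ≤ f (fun i => s i.castSucc)) ∧ (∀ k ≤ m, ∀ s, A k (g s)) ∧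
      ∀ k ≤ m, ∀ s t, s ≠ t → R k (g s) (g t) := by
    intro m f
    let I := Fin (m + 1) → Bool
    obtain ⟨g, hgf, hg⟩ := exists_le_forall_mem_of_dense (P := I → P)
      (κ := Fin (m + 1) × (I ⊕ {q : I × I // q.1 ≠ q.2}))
      (fun k g => Sum.elim (fun s => A k.1 (g s)) (fun q => R k.1 (g q.1.1) (g q.1.2)) k.2)
      (by
        rintro ⟨k, s | q⟩ g g' h hk
        · exact hA _ _ _ (h s) hk
        · exact hR _ _ _ _ _ (h _) (h _) hk)
      (by
        rintro ⟨k, s | ⟨⟨s, t⟩, hst⟩⟩ g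
        · obtain ⟨q, hq, hqA⟩ := hA' k (g s)
          refine ⟨Function.update g s q, update_le_self_iff.2 hq, ?_⟩
          simpa using hqA
        · obtain ⟨p, hp, q, hq, hpq⟩ := hR' k (g s) (g t)
          have hst' : s ≠ t := hst
          refine ⟨Function.update (Function.update g s p) t q, fun i => ?_, ?_⟩
          · by_cases hit : i = t
            · subst hit; simpa using hq
            · by_cases his : i = s
              · subst his; simpa [hit] using hp
              · simp [hit, his]
          · simpa [hst'] using hpq)
      Finset.univ (fun s => f fun i => s i.castSucc)
    refine ⟨g, hgf, fun k hk s => ?_, fun k hk s t hst => ?_⟩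
    · exact hg (⟨k, Nat.lt_succ_of_le hk⟩, Sum.inl s) (Finset.mem_univ _)
    · exact hg (⟨k, Nat.lt_succ_of_le hk⟩, Sum.inr ⟨(s, t), hst⟩) (Finset.mem_univ _)
  choose next hle hmeet hrel using step
  let T : ∀ m, (Fin m → Bool) → P := fun m => Nat.rec (fun _ => p₀) (fun m f => next m f) m
  refine ⟨fun x m => T m fun i => x i, fun x => antitone_nat_of_succ_le fun m => hle m (T m) _,
    fun x => rfl, fun x k => ⟨k + 1, hmeet k (T k) k le_rfl _⟩, fun x y hxy k => ?_⟩
  obtain ⟨j, hj⟩ := Function.ne_iff.1 hxy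
  refine ⟨max j k + 1, hrel (max j k) (T _) k (le_max_right _ _) _ _ fun h => hj ?_⟩
  exact congrFun h ⟨j, by omega⟩

/-- The form of `exists_branches` with arbitrary countable index sets. -/
theorem exists_branches_of_countable {K L : Type*} [Countable K] [Countable L]
    (A : K → P → Prop) (R : L → P → P → Prop)
    (hA : ∀ k p q, q ≤ p → A k p → A k q)
    (hR : ∀ k p q p' q', p' ≤ p → q' ≤ q → R k p q → R k p' q')
    (hA' : ∀ k p, ∃ q ≤ p, A k q)
    (hR' : ∀ k p q, ∃ p' ≤ p, ∃ q' ≤ q, R k p' q') (p₀ : P) :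
    ∃ Φ : (ℕ → Bool) → ℕ → P, (∀ x, Antitone (Φ x)) ∧ (∀ x, Φ x 0 = p₀) ∧
      (∀ x k, ∃ m, A k (Φ x m)) ∧ ∀ x y, x ≠ y → ∀ k, ∃ m, R k (Φ x m) (Φ y m) := by
  obtain ⟨a, ha⟩ := Countable.exists_injective_nat K
  obtain ⟨b, hb⟩ := Countable.exists_injective_nat L
  obtain ⟨Φ, h₁, h₂, h₃, h₄⟩ := exists_branches (fun m p => ∀ k, a k = m → A k p)
    (fun m p q => ∀ k, b k = m → R k p q) (fun m p q hqp h k hk => hA k p q hqp (h k hk))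
    (fun m p q p' q' hp hq h k hk => hR k p q p' q' hp hq (h k hk))
    (fun m p => by
      by_cases h : ∃ k, a k = m
      · obtain ⟨k, rfl⟩ := h
        obtain ⟨q, hq, hk⟩ := hA' k p
        exact ⟨q, hq, fun j hj => ha hj ▸ hk⟩
      · exact ⟨p, le_rfl, fun k hk => (h ⟨k, hk⟩).elim⟩)
    (fun m p q => by
      by_cases h : ∃ k, b k = m
      · obtain ⟨k, rfl⟩ := h
        obtain ⟨p', hp, q', hq, hk⟩ := hR' k p q
        exact ⟨p', hp, q', hq, fun j hj => hb hj ▸ hk⟩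
      · exact ⟨p, le_rfl, q, le_rfl, fun k hk => (h ⟨k, hk⟩).elim⟩) p₀
  refine ⟨Φ, h₁, h₂, fun x k => ?_, fun x y hxy k => ?_⟩
  · exact (h₃ x (a k)).imp fun m hm => hm k rfl
  · exact (h₄ x y hxy (b k)).imp fun m hm => hm k rfl

end Tree

namespace CylindricAlgebra

/-! ### The model of a Henkin filter -/

section Model

variable {n : ℕ} {A : Type*} [BooleanAlgebra A] [CylindricAlgebra (Fin n) A]
  {D : Type*} [BooleanAlgebra D] [CylindricAlgebra ℕ D]

theorem mem_of_substAll_mem {F : Order.PFilter D} {τ σ : Fin n → ℕ}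
    (h : ∀ i, diag (n + τ i) (n + σ i) ∈ F) {x : D} (hx : substAll τ x ∈ F) :
    substAll σ x ∈ F := by
  refine F.mem_of_le (inf_substAll_le τ σ x) (Order.PFilter.inf_mem ?_ hx)
  exact Finset.inf_induction (p := (· ∈ F)) F.top_mem
    (fun _ hx _ hy => Order.PFilter.inf_mem hx hy) fun i _ => h i

/-- Two Henkin constants `k`, `l` name the same point of the model if `d_{n+k,n+l}` is in `F`. -/
def diagSetoid (n : ℕ) (F : Order.PFilter D) : Setoid ℕ where
  r k l := diag (n + k) (n + l) ∈ F
  iseqv :=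
    { refl := fun k => by rw [diag_self]; exact F.top_mem
      symm := fun h => by rwa [diag_comm]
      trans := fun h h' => F.mem_of_le (diag_trans _ _ _) (Order.PFilter.inf_mem h h') }

/-- A proper filter that decides all `s_τ x` with `x ∈ A` and has Henkin witnesses yields a
homomorphism into a set algebra with a countable base, in which the type of the tuple named by `τ`
is `{x : s_τ x ∈ F}`. -/
theorem exists_isHom_of_henkin {e : A → Nr n D} (he : IsHom (Fin n) e) (F : Order.PFilter D)
    (hbot : ⊥ ∉ F)
    (hdec : ∀ (τ : Fin n → ℕ) (x : A), substAll τ (e x : D) ∈ F ∨ (substAll τ (e x : D))ᶜ ∈ F)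
    (hwit : ∀ (τ : Fin n → ℕ) (i : Fin n) (x : A), substAll τ (cyl (i : ℕ) (e x : D)) ∈ F →
      ∃ k, substAll (Function.update τ i k) (e x : D) ∈ F) :
    ∃ (M : Type) (f : A → Set (Fin n → M)), Nonempty M ∧ Countable M ∧ IsHom (Fin n) f ∧
      (∀ τ : Fin n → ℕ, ∃ s, ∀ x, s ∈ f x ↔ substAll τ (e x : D) ∈ F) ∧
      ∀ s, ∃ τ : Fin n → ℕ, ∀ x, s ∈ f x ↔ substAll τ (e x : D) ∈ F := by
  let S := diagSetoid n F
  have hout : ∀ k : ℕ, diag (n + (Quotient.mk S k).out) (n + k) ∈ F :=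
    fun k => Quotient.exact (Quotient.out_eq (Quotient.mk S k))
  have hout' : ∀ k : ℕ, diag (n + k) (n + (Quotient.mk S k).out) ∈ F := fun k => by
    rw [diag_comm]; exact hout k
  let rep : (Fin n → Quotient S) → Fin n → ℕ := fun s i => (s i).out
  let f : A → Set (Fin n → Quotient S) := fun x => {s | substAll (rep s) (e x : D) ∈ F}
  have hmk : ∀ (τ : Fin n → ℕ) (x : A),
      (fun i => Quotient.mk S (τ i)) ∈ f x ↔ substAll τ (e x : D) ∈ F := fun τ x =>
    ⟨mem_of_substAll_mem fun i => hout (τ i), mem_of_substAll_mem fun i => hout' (τ i)⟩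
  have hcompl : ∀ (τ : Fin n → ℕ) (x : A),
      (substAll τ (e x : D))ᶜ ∈ F ↔ substAll τ (e x : D) ∉ F := fun τ x =>
    ⟨fun h h' => hbot (by simpa using Order.PFilter.inf_mem h h'), (hdec τ x).resolve_left⟩
  have hmap_compl : ∀ x, f xᶜ = (f x)ᶜ := fun x => by
    ext s
    have : ((e xᶜ : Nr n D) : D) = (e x : D)ᶜ := by rw [he.map_compl]; rfl
    simp only [f, Set.mem_ofPred_eq, Set.mem_compl_iff, this, substAll_compl, hcompl]
  have hmap_inf : ∀ x y, f (x ⊓ y) = f x ⊓ f y := fun x y => by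
    ext s
    have : ((e (x ⊓ y) : Nr n D) : D) = (e x : D) ⊓ (e y : D) := by rw [he.map_inf]; rfl
    simp only [f, Set.mem_ofPred_eq, Set.inf_eq_inter, Set.mem_inter_iff, this, substAll_inf,
      Order.PFilter.inf_mem_iff]
  have hmap_bot : f ⊥ = ⊥ := by
    ext s
    have : ((e ⊥ : Nr n D) : D) = ⊥ := by rw [he.map_bot]; rfl
    simp [f, this, substAll_bot, hbot]
  refine ⟨Quotient S, f, ⟨Quotient.mk S 0⟩, inferInstance,
    { map_bot := hmap_bot
      map_top := by rw [← compl_bot, hmap_compl, hmap_bot, compl_bot]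
      map_sup := fun x y => by
        rw [← compl_inj_iff, ← hmap_compl, compl_sup, hmap_inf, hmap_compl, hmap_compl, compl_sup]
      map_inf := hmap_inf
      map_compl := hmap_compl
      map_cyl := fun i x => ?_
      map_diag := fun i j => ?_ }, fun τ => ⟨_, hmk τ⟩, fun s => ⟨rep s, fun x => Iff.rfl⟩⟩
  · have hc : ((e (cyl i x) : Nr n D) : D) = cyl (i : ℕ) (e x : D) := by rw [he.map_cyl]; rfl
    ext s
    change substAll (rep s) (e (cyl i x) : D) ∈ F ↔ ∃ t ∈ f x, ∀ j, j ≠ i → t j = s j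
    rw [hc]
    constructor
    · intro h
      obtain ⟨k, hk⟩ := hwit _ _ _ h
      refine ⟨_, (hmk _ x).2 hk, fun j hj => ?_⟩
      rw [Function.update_of_ne hj]
      exact Quotient.out_eq _
    · rintro ⟨t, ht, hts⟩
      have hrep : rep t = Function.update (rep s) i (rep t i) := by
        ext j
        rcases eq_or_ne j i with rfl | hj
        · simp
        · simp [rep, hts j hj, hj]
      change substAll (rep t) _ ∈ F at ht
      rw [hrep] at ht
      exact F.mem_of_le (substAll_update_le _ _ _ _) ht
  · have hd : ((e (diag i j) : Nr n D) : D) = diag (i : ℕ) (j : ℕ) := by rw [he.map_diag]; rfl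
    ext s
    change substAll (rep s) (e (diag i j) : D) ∈ F ↔ s i = s j
    rw [hd, substAll_diag]
    refine ⟨fun h => ?_, fun h => ?_⟩
    · rw [← Quotient.out_eq (s i), ← Quotient.out_eq (s j)]
      exact Quotient.sound h
    · simp only [rep, h, diag_self]
      exact F.top_mem

end Model

/-! ### Dense sets of conditions -/

section Conditions

variable {n : ℕ} {A : Type*} [BooleanAlgebra A] [CylindricAlgebra (Fin n) A]
  {D : Type*} [BooleanAlgebra D] [CylindricAlgebra ℕ D]

/-- The conditions of the construction: the non-zero finite-dimensional elements. -/
abbrev Condition (D : Type*) [BooleanAlgebra D] [CylindricAlgebra ℕ D] : Type _ :=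
  {p : D // p ≠ ⊥ ∧ IsFiniteDim p}

theorem Condition.exists_le (p : Condition D) {y : D} (hy : IsFiniteDim y)
    (h : (p : D) ⊓ y ≠ ⊥) : ∃ q ≤ p, (q : D) ≤ y :=
  ⟨⟨p ⊓ y, h, p.2.2.inf hy⟩, (inf_le_left : (p : D) ⊓ y ≤ p), inf_le_right⟩

theorem Condition.exists_le_or_le_compl (p : Condition D) {y : D} (hy : IsFiniteDim y) :
    ∃ q ≤ p, (q : D) ≤ y ∨ (q : D) ≤ yᶜ := by
  by_cases h : (p : D) ⊓ y = ⊥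
  · exact ⟨p, le_rfl, Or.inr (le_compl_iff_disjoint_right.2 (disjoint_iff.2 h))⟩
  · obtain ⟨q, hqp, hq⟩ := p.exists_le hy h
    exact ⟨q, hqp, Or.inl hq⟩

theorem Condition.exists_witness (p : Condition D) (τ : Fin n → ℕ) (i : Fin n) (x : Nr n D) :
    ∃ q ≤ p, (q : D) ≤ (substAll τ (cyl (i : ℕ) (x : D)))ᶜ ∨
      ∃ k, (q : D) ≤ substAll (Function.update τ i k) (x : D) := by
  have hy : IsFiniteDim (substAll τ (cyl (i : ℕ) (x : D))) :=
    ((isFiniteDim_coe x).cyl _).substList τ _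
  obtain ⟨q, hqp, hq | hq⟩ := p.exists_le_or_le_compl hy
  · obtain ⟨m, hm⟩ := q.2.2
    -- A variable above `m` and all `τ j` is fresh for `q` and for `s_τ x`.
    obtain ⟨N, hN⟩ := (Set.finite_range τ).bddAbove
    set k := max m (N + 1)
    have hk : ∀ j, k ≠ τ j := fun j => by
      have := hN (Set.mem_range_self j)
      omega
    have hne : (q : D) ⊓ substAll (Function.update τ i k) (x : D) ≠ ⊥ := by
      refine ne_bot_of_cyl_ne_bot (i := n + k) ?_
      rw [cyl_inf_left_of_fixed _ _ (hm _ (by omega)),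
        cyl_substAll_update τ i hk (x.2 _ (Nat.le_add_right _ _)), inf_eq_left.2 hq]
      exact q.2.1
    obtain ⟨r, hrq, hr⟩ := q.exists_le (isFiniteDim_substAll _ x) hne
    exact ⟨r, hrq.trans hqp, Or.inr ⟨k, hr⟩⟩
  · exact ⟨q, hqp, Or.inl hq⟩

/-- The condition `p` forces the type of the tuple `τ` to be the principal ultrafilter generated
by some `y`. -/
def Isolates (e : A → Nr n D) (τ : Fin n → ℕ) (p : D) : Prop :=
  ∃ y : A, p ≤ substAll τ (e y : D) ∧ ∀ x, ¬ y ≤ x → p ≤ (substAll τ (e x : D))ᶜ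

/-- The condition `p` forces an element into the type of `τ` which the condition `q` forces out of
the type of `σ`. -/
def Separates (e : A → Nr n D) (τ σ : Fin n → ℕ) (p q : D) : Prop :=
  ∃ x : A, p ≤ substAll τ (e x : D) ∧ q ≤ (substAll σ (e x : D))ᶜ

/-- An embedding preserving suprema equal to `1` takes sets with infimum `0` to sets without
non-zero finite-dimensional lower bounds. -/
theorem eq_bot_of_forall_le {e : A → Nr n D} (he : IsHom (Fin n) e)
    (hcomp : ∀ S : Set A, IsLUB S ⊤ → IsLUB (e '' S) ⊤) {U : Set A} (hU : IsGLB U ⊥) (p : D)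
    (hp : IsFiniteDim p) (hpU : ∀ x ∈ U, p ≤ e x) : p = ⊥ := by
  obtain ⟨y, hpy, hy⟩ := hp.exists_nr
  have hS : IsLUB (compl '' U) (⊤ : A) := by
    refine ⟨fun _ _ => le_top, fun z hz => ?_⟩
    have : zᶜ ≤ ⊥ := hU.2 fun x hx => compl_le_of_compl_le (hz ⟨x, hx, rfl⟩)
    rw [← compl_le_compl_iff_le, compl_top]
    exact this
  have h : (⊤ : Nr n D) ≤ yᶜ := (hcomp _ hS).2 (by
    rintro _ ⟨_, ⟨x, hx, rfl⟩, rfl⟩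
    rw [he.map_compl]
    exact compl_le_compl (hy (e x) (hpU x hx)))
  have hy0 : y = ⊥ := by
    rw [← compl_inj_iff, compl_bot]
    exact top_le_iff.1 h
  subst hy0
  exact le_bot_iff.1 hpy

/-- If the types of `τ` and `σ` cannot be made different below `p` and `q`, then `p` already
decides the type of `τ`. A complete type that is decided by one condition has a non-zero lower
bound, hence is principal. -/
theorem Condition.exists_separates_or_isolates {e : A → Nr n D} (he : IsHom (Fin n) e)
    (hcomp : ∀ S : Set A, IsLUB S ⊤ → IsLUB (e '' S) ⊤) (τ σ : Fin n → ℕ) (p q : Condition D) :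
    ∃ p' ≤ p, ∃ q' ≤ q, Separates e τ σ (p' : D) (q' : D) ∨ Isolates e τ (p' : D) := by
  have hcoe : ∀ (τ : Fin n → ℕ) x, substAll τ (e xᶜ : D) = (substAll τ (e x : D))ᶜ :=
    fun τ x => by rw [← substAll_compl, he.map_compl]; rfl
  have hfd := fun (τ : Fin n → ℕ) x => isFiniteDim_substAll τ (e x)
  by_cases h : ∃ x, (p : D) ⊓ substAll τ (e x : D) ≠ ⊥ ∧ (q : D) ⊓ (substAll σ (e x : D))ᶜ ≠ ⊥
  · obtain ⟨x, hp, hq⟩ := h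
    obtain ⟨p', hp', hpx⟩ := p.exists_le (hfd τ x) hp
    obtain ⟨q', hq', hqx⟩ := q.exists_le (hfd σ x).compl hq
    exact ⟨p', hp', q', hq', Or.inl ⟨x, hpx, hqx⟩⟩
  refine ⟨p, le_rfl, q, le_rfl, Or.inr ?_⟩
  have hor : ∀ x, (p : D) ≤ (substAll τ (e x : D))ᶜ ∨ (q : D) ≤ substAll σ (e x : D) := by
    intro x
    by_contra! hx
    refine h ⟨x, fun h' => hx.1 ?_, fun h' => hx.2 ?_⟩
    · exact le_compl_iff_disjoint_right.2 (disjoint_iff.2 h')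
    · rwa [← sdiff_eq, sdiff_eq_bot_iff] at h'
  have hdec : ∀ x, (p : D) ≤ substAll τ (e x : D) ∨ (p : D) ≤ (substAll τ (e x : D))ᶜ := by
    intro x
    rcases hor x with h₁ | h₁
    · exact Or.inr h₁
    rcases hor xᶜ with h₂ | h₂
    · left
      rwa [hcoe, compl_compl] at h₂
    · rw [hcoe] at h₂
      exact (q.2.1 (le_bot_iff.1 ((le_inf h₁ h₂).trans inf_compl_eq_bot.le))).elim
  have hglb : ¬ IsGLB {x | (p : D) ≤ substAll τ (e x : D)} ⊥ := fun hglb =>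
    p.2.1 (eq_bot_of_le_substList τ (eq_bot_of_forall_le he hcomp hglb) _ p p.2.2 fun x hx => hx)
  obtain ⟨y, hy, hy0⟩ : ∃ y, y ∈ lowerBounds {x | (p : D) ≤ substAll τ (e x : D)} ∧ ¬ y ≤ ⊥ := by
    by_contra! hcon
    exact hglb ⟨fun _ _ => bot_le, hcon⟩
  refine ⟨y, (hdec y).resolve_right fun hpy => hy0 ?_,
    fun x hyx => (hdec x).resolve_left fun hpx => hyx (hy hpx)⟩
  rw [← hcoe] at hpy
  exact (le_compl_self.1 (hy hpy)).le

end Conditions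

end CylindricAlgebra

/-! ### Omitting fewer than continuum many types -/

section Omitting

open CylindricAlgebra

/-- The filter generated by a descending sequence. -/
def filterOfAntitone {D : Type*} [SemilatticeInf D] [OrderTop D] (p : ℕ → D) (hp : Antitone p) :
    Order.PFilter D :=
  Order.IsPFilter.toPFilter (F := {y | ∃ m, p m ≤ y}) <| Order.IsPFilter.of_def ⟨⊤, 0, le_top⟩
    (by
      rintro x ⟨m, hm⟩ y ⟨k, hk⟩
      exact ⟨x ⊓ y, ⟨max m k, le_inf ((hp (le_max_left _ _)).trans hm)
        ((hp (le_max_right _ _)).trans hk)⟩, inf_le_left, inf_le_right⟩)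
    (fun {_ _} hxy ⟨m, hm⟩ => ⟨m, hm.trans hxy⟩)

/-- There are `2^ℵ₀` Henkin filters containing a given condition such that no non-principal
ultrafilter of `A` is the type of a tuple in two of them. -/
theorem exists_henkin_filters {n : ℕ} {A : Type*} [BooleanAlgebra A] [CylindricAlgebra (Fin n) A]
    [Countable A] {D : Type*} [BooleanAlgebra D] [CylindricAlgebra ℕ D] {e : A → Nr n D}
    (he : IsHom (Fin n) e) (hcomp : ∀ S : Set A, IsLUB S ⊤ → IsLUB (e '' S) ⊤)
    (p₀ : Condition D) :
    ∃ F : (ℕ → Bool) → Order.PFilter D, ∀ b, (p₀ : D) ∈ F b ∧ ⊥ ∉ F b ∧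
      (∀ (τ : Fin n → ℕ) (x : A),
        substAll τ (e x : D) ∈ F b ∨ (substAll τ (e x : D))ᶜ ∈ F b) ∧
      (∀ (τ : Fin n → ℕ) (i : Fin n) (x : A), substAll τ (cyl (i : ℕ) (e x : D)) ∈ F b →
        ∃ k, substAll (Function.update τ i k) (e x : D) ∈ F b) ∧
      ∀ b', b ≠ b' → ∀ τ σ : Fin n → ℕ,
        (∃ p ∈ F b, ∃ q ∈ F b', Separates e τ σ p q) ∨ ∃ p ∈ F b, Isolates e τ p := by
  obtain ⟨Φ, hanti, hzero, hmeet, hsep⟩ := exists_branches_of_countable (P := Condition D)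
    (K := ((Fin n → ℕ) × A) ⊕ ((Fin n → ℕ) × Fin n × A)) (L := (Fin n → ℕ) × (Fin n → ℕ))
    (fun k p => Sum.elim
      (fun k => (p : D) ≤ substAll k.1 (e k.2 : D) ∨ (p : D) ≤ (substAll k.1 (e k.2 : D))ᶜ)
      (fun k => (p : D) ≤ (substAll k.1 (cyl (k.2.1 : ℕ) (e k.2.2 : D)))ᶜ ∨
        ∃ j, (p : D) ≤ substAll (Function.update k.1 k.2.1 j) (e k.2.2 : D)) k)
    (fun l p q => Separates e l.1 l.2 (p : D) (q : D) ∨ Isolates e l.1 (p : D))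
    (by
      rintro (k | k) p q hqp
      · exact Or.imp (le_trans hqp) (le_trans hqp)
      · exact Or.imp (le_trans hqp) (Exists.imp fun j => le_trans hqp))
    (by
      rintro l p q p' q' hp hq (⟨x, h₁, h₂⟩ | ⟨y, h₁, h₂⟩)
      · exact Or.inl ⟨x, le_trans hp h₁, le_trans hq h₂⟩
      · exact Or.inr ⟨y, le_trans hp h₁, fun x hx => le_trans hp (h₂ x hx)⟩)
    (by
      rintro (⟨τ, x⟩ | ⟨τ, i, x⟩) p
      · exact p.exists_le_or_le_compl (isFiniteDim_substAll τ (e x))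
      · exact p.exists_witness τ i (e x))
    (fun l p q => Condition.exists_separates_or_isolates he hcomp l.1 l.2 p q) p₀
  refine ⟨fun b => filterOfAntitone (fun m => (Φ b m : D)) fun m k h => hanti b h, fun b =>
    ⟨⟨0, (congrArg Subtype.val (hzero b)).le⟩, fun ⟨m, hm⟩ => (Φ b m).2.1 (le_bot_iff.1 hm), fun τ x => ?_,
      fun τ i x => ?_, fun b' hbb τ σ => ?_⟩⟩
  · obtain ⟨m, hm⟩ := hmeet b (Sum.inl (τ, x))
    exact hm.imp (fun h => ⟨m, h⟩) fun h => ⟨m, h⟩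
  · rintro ⟨k, hk⟩
    obtain ⟨m, hm | ⟨j, hj⟩⟩ := hmeet b (Sum.inr (τ, i, x))
    · refine ((Φ b (max k m)).2.1 (le_bot_iff.1 ?_)).elim
      exact (le_inf (le_trans (hanti b (le_max_left k m)) hk)
        (le_trans (hanti b (le_max_right k m)) hm)).trans inf_compl_eq_bot.le
    · exact ⟨j, m, hj⟩
  · obtain ⟨m, hm⟩ := hsep b b' hbb (τ, σ)
    exact hm.imp (fun h => ⟨_, ⟨m, le_rfl⟩, _, ⟨m, le_rfl⟩, h⟩) fun h => ⟨_, ⟨m, le_rfl⟩, h⟩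

end Omitting

theorem mainTheorem11 (n : ℕ) (A : Type u) [BooleanAlgebra A] [CylindricAlgebra (Fin n) A]
    [Countable A] (hA : CylindricAlgebra.MemScNr.{u, v} n A)
    (ι : Type w) (hι : Cardinal.mk ι < 2 ^ Cardinal.aleph0) (X : ι → Set A)
    (hX : ∀ i, IsBooleanUltrafilter (X i)) (hXnp : ∀ i, ¬ IsPrincipalFilter (X i)) :
    ∀ a : A, a ≠ ⊥ →
      ∃ (M : Type) (f : A → Set (Fin n → M)), Nonempty M ∧ Countable M ∧
        CylindricAlgebra.IsHom (Fin n) f ∧ f a ≠ ∅ ∧ ∀ i, (⋂ x ∈ X i, f x) = ∅ := by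
  open CylindricAlgebra in
  intro a ha
  obtain ⟨D, _, _, e, he, hinj, hcomp⟩ := hA
  have hea : e a ≠ ⊥ := fun h => ha (hinj (h.trans he.map_bot.symm))
  -- The identity tuple is to satisfy `a`.
  obtain ⟨F, hF⟩ := exists_henkin_filters he hcomp
    ⟨substAll (fun i : Fin n => (i : ℕ)) (e a : D),
      substList_ne_bot Fin.val_injective (List.nodup_finRange n) hea, isFiniteDim_substAll _ _⟩
  choose hFa hFbot hdec hwit hsep using hF
  have hcompl : ∀ b (τ : Fin n → ℕ) (x : A), substAll τ (e x : D) ∈ F b →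
      (substAll τ (e x : D))ᶜ ∈ F b → False := fun b τ x h h' =>
    hFbot b (by simpa using Order.PFilter.inf_mem h h')
  have hcoe : ∀ (τ : Fin n → ℕ) x, substAll τ (e xᶜ : D) = (substAll τ (e x : D))ᶜ :=
    fun τ x => by rw [← substAll_compl, he.map_compl]; rfl
  -- A branch whose filter realizes no `X i` exists, as otherwise `ι` would be too large.
  obtain ⟨b, hb⟩ : ∃ b, ∀ i (τ : Fin n → ℕ), ∃ x ∈ X i, substAll τ (e x : D) ∉ F b := by
    by_contra! hbad
    choose j τ hτ using hbad
    have hj : Function.Injective j := by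
      intro b b' hbb
      by_contra hne
      have hmem : ∀ x, substAll (τ b) (e x : D) ∈ F b → x ∈ X (j b) := fun x hx =>
        ((hX (j b)).mem_or_compl_mem x).resolve_right fun hx' =>
          hcompl b (τ b) x hx (hcoe (τ b) x ▸ hτ b _ hx')
      rcases hsep b b' hne (τ b) (τ b') with ⟨p, hp, q, hq, x, hpx, hqx⟩ | ⟨p, hp, y, hpy, hy⟩
      · have hx := hmem x ((F b).mem_of_le hpx hp)
        rw [hbb] at hx
        exact hcompl b' (τ b') x (hτ b' x hx) ((F b').mem_of_le hqx hq)
      · refine hXnp (j b) ⟨y, Set.Subset.antisymm (fun x hx => ?_) fun x hx => ?_⟩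
        · by_contra hyx
          exact hcompl b (τ b) x (hτ b x hx) ((F b).mem_of_le (hy x hyx) hp)
        · exact (hX (j b)).mem_of_le y x (hmem y ((F b).mem_of_le hpy hp)) hx
    have hle := Cardinal.mk_le_of_injective (α := ULift.{w} (ℕ → Bool)) (β := ι)
      (f := fun b => j b.down) fun b b' h => ULift.down_injective (hj h)
    refine hι.not_ge (le_trans (le_of_eq ?_) hle)
    simp
  obtain ⟨M, f, hM, hMc, hf, hreal, htype⟩ :=
    exists_isHom_of_henkin he (F b) (hFbot b) (hdec b) (hwit b)
  refine ⟨M, f, hM, hMc, hf, ?_, fun i => ?_⟩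
  · obtain ⟨s, hs⟩ := hreal fun i : Fin n => (i : ℕ)
    exact Set.nonempty_iff_ne_empty.1 ⟨s, (hs a).2 (hFa b)⟩
  · refine Set.eq_empty_iff_forall_notMem.2 fun s hs => ?_
    obtain ⟨τ, hτ⟩ := htype s
    obtain ⟨x, hx, hxF⟩ := hb i τ
    exact hxF ((hτ x).1 (Set.mem_iInter₂.1 hs x hx))
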